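/- For integers $n,p\ge 1$ let $S_{n,p}$ denote the Nielsen polylogarithm $$S_{n,p}(z)=\frac{(-1)^{n+p-1}}{(n-1)!\,p!}\int_0^1 \log^{n-1}(t)\,\log^{p}(1-zt)\,\frac{dt}{t},$$ where $z\in\mathbb{C}\setminus(1,\infty)$ and the logarithms are principal, and let $\zeta$ be the Riemann zeta function. Then $$\frac52\,S_{6,2}(-1)-S_{5,3}(-1)=-\frac{917}{768}\,\zeta(8)+\frac12\,\zeta(3)\,\zeta(5)+\frac14\,\zeta(2)\,\zeta(3)^2 .$$ -/

import Mathlib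

/-- Nielsen's generalised polylogarithm
`S_{n,p}(z) = (-1)^(n+p-1) / ((n-1)! p!) * ∫_0^1 log^(n-1)(t) log^p(1 - z t) dt/t`,
for integers `n, p ≥ 1` (the index `n = 0` carries no meaning here), with the principal
branch of the logarithm, so that `z` ranges over the complex plane cut along `(1, ∞)`. -/
noncomputable def nielsenS (n p : ℕ) (z : ℂ) : ℂ :=
  (-1 : ℂ) ^ (n + p - 1) / ((Nat.factorial (n - 1) : ℂ) * (Nat.factorial p : ℂ)) *
    ∫ t : ℝ in (0 : ℝ)..1,
      (Real.log t : ℂ) ^ (n - 1) * Complex.log (1 - z * (t : ℂ)) ^ p / (t : ℂ)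

/-!
The values `S_{n,p}(-1)` are, up to sign, the coefficients of `x ^ (n - 1) * y ^ p` in
`F(x, y) = ∫₀¹ t ^ (x - 1) * (1 + t) ^ (-y) dt`, apart from the pole `1 / x` coming from `p = 0`.
The inversion `t ↦ 1 / t` folds the Beta integral over `(0, ∞)` onto `(0, 1)`
(`integral_add_integral_eq_Gamma`) and gives the functional equation
`F(x, y) + F(y - x, y) = B(x, y - x)`.
With `x = y / 2 + u` it determines the part of `F` that is even in `u`. In total degree `7` the
coefficient of `u ^ 4 * y ^ 3` of that part is
`15 / 4 * S_{7,1}(-1) - 5 / 2 * S_{6,2}(-1) + S_{5,3}(-1)` and the coefficient of `u ^ 6 * y` is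
`S_{7,1}(-1)`, so that the combination in the theorem is determined as well.

On the other side, Euler's product gives
`x * z / (x + z) * B(x, z) = exp (∑_{k ≥ 2} (-1) ^ k * ζ(k) / k * (x ^ k + z ^ k - (x + z) ^ k))`
(`abs_log_Gamma_ratio_sub_taylor_le`), so the coefficients are polynomials in zeta values. In weight
`8` these are the even ones, which are powers of `π` with rational factors, and the products
`ζ(3) * ζ(5)` and `ζ(2) * ζ(3) ^ 2`.

The comparison of coefficients is made along rays `(x, z) = (a * ε, c * ε)`, where both sides have
asymptotic expansions in `ε → 0+` whose coefficients of `ε ^ 8` must agree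
(`powMoment_add_powMoment`). The forms in question being even in `u`, four rays are enough.
-/

open Filter Topology Asymptotics Polynomial

/-! ### The Taylor expansion of the logarithm of the Beta function -/

/-- The values `ζ(k)`, `k ≥ 2`, of the Riemann zeta function at integers, as real series
(`0` for `k ≤ 1`, where the series diverges). -/
noncomputable def zetaSeries (k : ℕ) : ℝ := ∑' m : ℕ, 1 / ((m : ℝ) + 1) ^ k

lemma summable_zetaSeries {k : ℕ} (hk : 2 ≤ k) :
    Summable fun m : ℕ => 1 / ((m : ℝ) + 1) ^ k := by
  have h := (summable_nat_add_iff 1).2 (Real.summable_one_div_nat_pow.2 (by lia : 1 < k))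
  simpa using h

lemma ofReal_zetaSeries {k : ℕ} (hk : 2 ≤ k) : (zetaSeries k : ℂ) = riemannZeta k := by
  have hk' : 1 < ((k : ℂ)).re := by simpa using (by lia : 1 < k)
  rw [zeta_eq_tsum_one_div_nat_add_one_cpow hk', zetaSeries, Complex.ofReal_tsum]
  simp

lemma logGammaSeq_eq_sub_sum_log {x : ℝ} (hx : 0 < x) (n : ℕ) :
    Real.BohrMollerup.logGammaSeq x n =
      x * Real.log n - Real.log x - ∑ m ∈ Finset.range n, Real.log (1 + x / (m + 1)) := by
  have hfac : Real.log (n.factorial) = ∑ m ∈ Finset.range n, Real.log ((m : ℝ) + 1) := by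
    rw [← Finset.prod_range_add_one_eq_factorial, Nat.cast_prod, Real.log_prod]
    · simp
    · intro i _; positivity
  have hsum : ∑ m ∈ Finset.range n, Real.log (x + (m + 1 : ℕ)) =
      ∑ m ∈ Finset.range n, (Real.log ((m : ℝ) + 1) + Real.log (1 + x / (m + 1))) := by
    refine Finset.sum_congr rfl fun m _ => ?_
    rw [← Real.log_mul (by positivity) (by positivity)]
    congr 1
    push_cast
    field_simp
    ring
  rw [Real.BohrMollerup.logGammaSeq, Finset.sum_range_succ', hsum, Finset.sum_add_distrib, hfac]
  simp
  ring

/-- Euler's product for `x z / (x + z) * B(x, z)`, in logarithmic form. -/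
lemma tendsto_sum_log_Gamma_ratio {x z : ℝ} (hx : 0 < x) (hz : 0 < z) :
    Tendsto (fun n : ℕ => ∑ m ∈ Finset.range n, (Real.log (1 + (x + z) / (m + 1)) -
        Real.log (1 + x / (m + 1)) - Real.log (1 + z / (m + 1)))) atTop
      (𝓝 (Real.log (x * z / (x + z) * (Real.Gamma x * Real.Gamma z / Real.Gamma (x + z))))) := by
  have key : ∀ {y : ℝ}, 0 < y →
      Tendsto (Real.BohrMollerup.logGammaSeq y) atTop (𝓝 (Real.log (Real.Gamma y))) :=
    fun hy => Real.BohrMollerup.tendsto_log_gamma hy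
  have hΓx := Real.Gamma_pos_of_pos hx
  have hΓz := Real.Gamma_pos_of_pos hz
  have hΓ := Real.Gamma_pos_of_pos (add_pos hx hz)
  have hlim := (((key hx).add (key hz)).sub (key (add_pos hx hz))).add
    (tendsto_const_nhds (x := Real.log x + Real.log z - Real.log (x + z)))
  convert hlim using 1
  · ext n
    rw [logGammaSeq_eq_sub_sum_log hx, logGammaSeq_eq_sub_sum_log hz,
      logGammaSeq_eq_sub_sum_log (add_pos hx hz), Finset.sum_sub_distrib, Finset.sum_sub_distrib]
    ring
  · rw [Real.log_mul (by positivity) (by positivity), Real.log_div (by positivity) (by positivity),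
      Real.log_mul (by positivity) (by positivity), Real.log_div (by positivity) (by positivity),
      Real.log_mul (by positivity) (by positivity)]
    ring_nf

lemma abs_log_one_add_sub_taylor_le {h : ℝ} (h0 : 0 ≤ h) (h1 : h ≤ 1 / 2) (n : ℕ) :
    |Real.log (1 + h) - (h + ∑ k ∈ Finset.range n, (-1) ^ (k + 1) / (k + 2) * h ^ (k + 2))| ≤
      2 * h ^ (n + 2) := by
  have H := Real.abs_log_sub_add_sum_range_le (x := -h) (by rw [abs_neg, abs_of_nonneg h0]; linarith)
    (n + 1)
  rw [abs_neg, abs_of_nonneg h0, sub_neg_eq_add, Finset.sum_range_succ'] at H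
  have e : ∑ k ∈ Finset.range n, (-h) ^ (k + 1 + 1) / (((k + 1 : ℕ) : ℝ) + 1) =
      -∑ k ∈ Finset.range n, (-1) ^ (k + 1) / ((k : ℝ) + 2) * h ^ (k + 2) := by
    rw [← Finset.sum_neg_distrib]
    refine Finset.sum_congr rfl fun k _ => ?_
    rw [neg_pow h]
    push_cast
    ring
  rw [e] at H
  calc _ = _ := ?_
    _ ≤ _ := H
    _ ≤ _ := ?_
  · congr 1
    simp
    ring
  · rw [div_le_iff₀ (by linarith)]
    have : 0 ≤ h ^ (n + 2) := by positivity
    show h ^ (n + 2) ≤ _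
    nlinarith

/-- The linear terms of the three logarithms in Euler's product cancel, so that the Taylor
coefficients are zeta values at integers `≥ 2`. -/
lemma abs_log_Gamma_ratio_sub_taylor_le {x z : ℝ} (hx : 0 < x) (hz : 0 < z) (hxz : x + z ≤ 1 / 2)
    (n : ℕ) :
    |Real.log (x * z / (x + z) * (Real.Gamma x * Real.Gamma z / Real.Gamma (x + z))) -
      ∑ k ∈ Finset.range n, (-1) ^ (k + 1) / (k + 2) * ((x + z) ^ (k + 2) - x ^ (k + 2) -
        z ^ (k + 2)) * zetaSeries (k + 2)| ≤ 6 * (x + z) ^ (n + 2) * zetaSeries (n + 2) := by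
  have hpart : ∀ k : ℕ, Tendsto (fun N => ∑ m ∈ Finset.range N, 1 / ((m : ℝ) + 1) ^ (k + 2)) atTop
      (𝓝 (zetaSeries (k + 2))) := fun k =>
    (summable_zetaSeries (by lia)).hasSum.tendsto_sum_nat
  have hmain := (tendsto_sum_log_Gamma_ratio hx hz).sub
    (tendsto_finsetSum (Finset.range n) fun k _ => (hpart k).const_mul
      ((-1 : ℝ) ^ (k + 1) / (k + 2) * ((x + z) ^ (k + 2) - x ^ (k + 2) - z ^ (k + 2))))
  refine le_of_tendsto_of_tendsto' hmain.abs ((hpart n).const_mul (6 * (x + z) ^ (n + 2))) ?_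
  intro N
  simp_rw [Finset.mul_sum]
  rw [Finset.sum_comm, ← Finset.sum_sub_distrib]
  refine (Finset.abs_sum_le_sum_abs _ _).trans (Finset.sum_le_sum fun m _ => ?_)
  have hm : (0 : ℝ) < (m : ℝ) + 1 := by positivity
  have hm1 : (1 : ℝ) ≤ (m : ℝ) + 1 := by simp
  have small : ∀ {y : ℝ}, 0 < y → y ≤ x + z → 0 ≤ y / (m + 1) ∧ y / (m + 1) ≤ 1 / 2 ∧
      (y / ((m : ℝ) + 1)) ^ (n + 2) ≤ (x + z) ^ (n + 2) * (1 / ((m : ℝ) + 1) ^ (n + 2)) := by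
    intro y hy hyz
    refine ⟨by positivity, (div_le_self hy.le hm1).trans (hyz.trans hxz), ?_⟩
    rw [div_pow, mul_one_div]
    gcongr
  obtain ⟨a0, a1, a2⟩ := small (add_pos hx hz) le_rfl
  obtain ⟨b0, b1, b2⟩ := small hx (by linarith)
  obtain ⟨c0, c1, c2⟩ := small hz (by linarith)
  have A := abs_log_one_add_sub_taylor_le a0 a1 n
  have B := abs_log_one_add_sub_taylor_le b0 b1 n
  have C := abs_log_one_add_sub_taylor_le c0 c1 n
  have e : ∑ k ∈ Finset.range n, (-1 : ℝ) ^ (k + 1) / (k + 2) * ((x + z) ^ (k + 2) - x ^ (k + 2) -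
        z ^ (k + 2)) * (1 / ((m : ℝ) + 1) ^ (k + 2)) =
      ∑ k ∈ Finset.range n, (-1 : ℝ) ^ (k + 1) / (k + 2) * ((x + z) / (m + 1)) ^ (k + 2) -
      ∑ k ∈ Finset.range n, (-1 : ℝ) ^ (k + 1) / (k + 2) * (x / (m + 1)) ^ (k + 2) -
      ∑ k ∈ Finset.range n, (-1 : ℝ) ^ (k + 1) / (k + 2) * (z / (m + 1)) ^ (k + 2) := by
    rw [← Finset.sum_sub_distrib, ← Finset.sum_sub_distrib]
    refine Finset.sum_congr rfl fun k _ => ?_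
    rw [div_pow, div_pow, div_pow]
    ring
  rw [e]
  have hlin : (x + z) / ((m : ℝ) + 1) = x / (m + 1) + z / (m + 1) := add_div _ _ _
  rw [abs_le] at A B C ⊢
  constructor <;> linarith [A.1, A.2, B.1, B.2, C.1, C.2]

/-! ### Polynomial asymptotic expansions at `0` from the right -/

/-- Uniqueness of asymptotic expansions. -/
lemma Polynomial.coeff_eq_zero_of_eval_isBigO_pow {n : ℕ} {P : ℝ[X]}
    (h : (fun ε : ℝ => P.eval ε) =O[𝓝[>] 0] fun ε : ℝ => ε ^ n) {k : ℕ} (hk : k < n) :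
    P.coeff k = 0 := by
  induction n generalizing P k with
  | zero => lia
  | succ n ih =>
    have hid : Tendsto (fun ε : ℝ => ε) (𝓝[>] 0) (𝓝 0) := tendsto_id.mono_left nhdsWithin_le_nhds
    have hpow : Tendsto (fun ε : ℝ => ε ^ (n + 1)) (𝓝[>] 0) (𝓝 0) := by
      simpa using hid.pow (n + 1)
    have h0 : P.coeff 0 = 0 := by
      rw [coeff_zero_eq_eval_zero]
      refine tendsto_nhds_unique ?_ (h.trans_tendsto hpow)
      exact P.continuous.continuousAt.tendsto.comp hid
    rcases k with _ | k
    · exact h0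
    · rw [← coeff_divX]
      refine ih ?_ (by lia)
      have hinv := (isBigO_refl (fun ε : ℝ => ε⁻¹) (𝓝[>] 0)).mul h
      refine hinv.congr' ?_ ?_ <;> filter_upwards [self_mem_nhdsWithin] with ε hε
      · have hε' : ε ≠ 0 := ne_of_gt hε
        conv_lhs => rw [← divX_mul_X_add P, h0]
        simp
        field_simp
      · have hε' : ε ≠ 0 := ne_of_gt hε
        field_simp
        ring

/-- The exponential series truncated after the fourth power of `q`. If `X ^ 2` divides `q` then it
agrees with `exp ∘ q` up to `O(ε ^ 10)`; its terms of degree above `9` are not discarded. -/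
noncomputable def expTrunc (q : ℝ[X]) : ℝ[X] :=
  1 + q + C (1 / 2) * q ^ 2 + C (1 / 6) * q ^ 3 + C (1 / 24) * q ^ 4

lemma exp_sub_expTrunc_isBigO {g : ℝ → ℝ} {r : ℝ[X]}
    (hg : (fun ε => g ε - (X ^ 2 * r).eval ε) =O[𝓝[>] 0] fun ε : ℝ => ε ^ 9) :
    (fun ε => Real.exp (g ε) - (expTrunc (X ^ 2 * r)).eval ε) =O[𝓝[>] 0] fun ε : ℝ => ε ^ 9 := by
  set q := X ^ 2 * r with hq
  have hid : Tendsto (fun ε : ℝ => ε) (𝓝[>] 0) (𝓝 0) := tendsto_id.mono_left nhdsWithin_le_nhds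
  have hpow : Tendsto (fun ε : ℝ => ε ^ 9) (𝓝[>] 0) (𝓝 0) := by simpa using hid.pow 9
  have hqO : (fun ε => q.eval ε) =O[𝓝[>] 0] fun ε : ℝ => ε ^ 2 := by
    have hr : (fun ε => r.eval ε) =O[𝓝[>] 0] fun _ : ℝ => (1 : ℝ) :=
      (r.continuous.continuousAt.tendsto.comp hid).isBigO_one ℝ
    simpa [hq] using (isBigO_refl (fun ε : ℝ => ε ^ 2) (𝓝[>] 0)).mul hr
  have hq0 : Tendsto (fun ε => q.eval ε) (𝓝[>] 0) (𝓝 0) :=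
    hqO.trans_tendsto (by simpa using hid.pow 2)
  have hd0 : Tendsto (fun ε => g ε - q.eval ε) (𝓝[>] 0) (𝓝 0) := hg.trans_tendsto hpow
  have h1 : (fun ε => Real.exp (g ε) - Real.exp (q.eval ε)) =O[𝓝[>] 0] fun ε : ℝ => ε ^ 9 := by
    have hexp1 : (fun y : ℝ => Real.exp y - 1) =O[𝓝 0] fun y => y := by
      have := (Real.hasDerivAt_exp 0).isBigO_sub
      simpa using this
    have hb : (fun ε => Real.exp (q.eval ε)) =O[𝓝[>] 0] fun _ : ℝ => (1 : ℝ) :=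
      ((Real.continuous_exp.tendsto 0).comp hq0).isBigO_one ℝ
    have := hb.mul ((hexp1.comp_tendsto hd0).trans hg)
    refine this.congr (fun ε => ?_) (fun ε => one_mul _)
    simp only [Function.comp, mul_sub, ← Real.exp_add, mul_one]
    ring_nf
  have h2 : (fun ε => Real.exp (q.eval ε) - (expTrunc q).eval ε) =O[𝓝[>] 0]
      fun ε : ℝ => ε ^ 9 := by
    have hexp : (fun y : ℝ => Real.exp y - ∑ m ∈ Finset.range 5, y ^ m / m.factorial) =O[𝓝 0]
        fun y => y ^ 5 := by
      refine IsBigO.of_bound ((Nat.succ 5 : ℝ) / ((Nat.factorial 5 : ℝ) * 5)) ?_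
      filter_upwards [Metric.closedBall_mem_nhds (0 : ℝ) one_pos] with y hy
      have hy1 : |y| ≤ 1 := by simpa using hy
      have := Real.exp_bound hy1 (n := 5) (by norm_num)
      rw [Real.norm_eq_abs, Real.norm_eq_abs, abs_pow, mul_comm]
      simpa using this
    have h3 := (hexp.comp_tendsto hq0).trans (hqO.pow 5)
    have h4 : (fun ε : ℝ => (ε ^ 2) ^ 5) =O[𝓝[>] 0] fun ε : ℝ => ε ^ 9 := by
      have := (hid.isBigO_one ℝ).mul (isBigO_refl (fun ε : ℝ => ε ^ 9) (𝓝[>] 0))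
      refine this.congr (fun ε => by ring) (fun ε => one_mul _)
    refine (h3.trans h4).congr_left fun ε => ?_
    simp [expTrunc, Finset.sum_range_succ, Nat.factorial]
    ring
  refine (h1.add h2).congr_left fun ε => ?_
  ring

/-! ### The Beta integral folded onto the unit interval -/

open MeasureTheory in
/-- The substitution `s = t / (1 + t)` on the left half of the Beta integral. -/
lemma integral_rpow_mul_one_add_rpow_eq (x z : ℝ) :
    ∫ t in (0 : ℝ)..1, t ^ (x - 1) * (1 + t) ^ (-(x + z)) =
      ∫ s in (0 : ℝ)..(1 / 2), s ^ (x - 1) * (1 - s) ^ (z - 1) := by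
  rw [intervalIntegral.integral_of_le (by norm_num), intervalIntegral.integral_of_le (by norm_num),
    integral_Ioc_eq_integral_Ioo, integral_Ioc_eq_integral_Ioo]
  have himg : (fun t : ℝ => t / (1 + t)) '' Set.Ioo 0 1 = Set.Ioo 0 (1 / 2) := by
    ext s
    constructor
    · rintro ⟨t, ⟨h0, h1⟩, rfl⟩
      refine ⟨by positivity, ?_⟩
      show t / (1 + t) < 1 / 2
      rw [div_lt_div_iff₀ (by linarith) (by norm_num)]
      linarith
    · rintro ⟨h0, h1⟩
      have h2 : 0 < 1 - s := by linarith
      refine ⟨s / (1 - s), ⟨by positivity, ?_⟩, ?_⟩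
      · rw [div_lt_one h2]; linarith
      · have : 1 + s / (1 - s) = 1 / (1 - s) := by field_simp; ring
        show s / (1 - s) / (1 + s / (1 - s)) = s
        rw [this]
        field_simp
  have hinj : Set.InjOn (fun t : ℝ => t / (1 + t)) (Set.Ioo 0 1) := by
    intro t ht u hu h
    have h1 : (0 : ℝ) < 1 + t := by linarith [ht.1]
    have h2 : (0 : ℝ) < 1 + u := by linarith [hu.1]
    have h3 : t / (1 + t) = u / (1 + u) := h
    rw [div_eq_div_iff h1.ne' h2.ne'] at h3
    linarith
  have hder : ∀ t ∈ Set.Ioo (0 : ℝ) 1,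
      HasDerivWithinAt (fun t : ℝ => t / (1 + t)) (1 / (1 + t) ^ 2) (Set.Ioo 0 1) t := by
    intro t ht
    have h1 : (1 : ℝ) + t ≠ 0 := by linarith [ht.1]
    have := ((hasDerivAt_id t).div ((hasDerivAt_id t).const_add 1) h1).hasDerivWithinAt
      (s := Set.Ioo 0 1)
    refine this.congr_deriv ?_
    simp [id]
  rw [← himg, integral_image_eq_integral_abs_deriv_smul measurableSet_Ioo hder hinj]
  refine setIntegral_congr_fun measurableSet_Ioo fun t ht => ?_
  have h0 : 0 < t := ht.1
  have h1 : (0 : ℝ) < 1 + t := by linarith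
  have e : 1 - t / (1 + t) = (1 + t)⁻¹ := by field_simp; ring
  simp only [smul_eq_mul]
  rw [e, abs_of_pos (by positivity), Real.div_rpow h0.le h1.le, Real.inv_rpow h1.le,
    ← Real.rpow_neg h1.le, div_eq_mul_inv (t ^ _), ← Real.rpow_neg h1.le, one_div,
    ← Real.rpow_natCast, ← Real.rpow_neg h1.le]
  rw [show -(x + z) = -((2 : ℕ) : ℝ) + -(x - 1) + -(z - 1) by push_cast; ring, Real.rpow_add h1,
    Real.rpow_add h1]
  ring

/-- The Beta integral over `(0, ∞)`, folded onto `(0, 1)` by the inversion `t ↦ 1 / t`. -/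
lemma integral_add_integral_eq_Gamma {x z : ℝ} (hx : 0 < x) (hz : 0 < z) :
    (∫ t in (0 : ℝ)..1, t ^ (x - 1) * (1 + t) ^ (-(x + z))) +
      ∫ t in (0 : ℝ)..1, t ^ (z - 1) * (1 + t) ^ (-(x + z)) =
      Real.Gamma x * Real.Gamma z / Real.Gamma (x + z) := by
  have hint : IntervalIntegrable (fun s : ℝ => s ^ (x - 1) * (1 - s) ^ (z - 1))
      MeasureTheory.volume 0 1 ∧
      ∫ s in (0 : ℝ)..1, s ^ (x - 1) * (1 - s) ^ (z - 1) =
      Real.Gamma x * Real.Gamma z / Real.Gamma (x + z) := by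
    have hcongr : Set.EqOn (fun s : ℝ => (s : ℂ) ^ ((x : ℂ) - 1) * (1 - (s : ℂ)) ^ ((z : ℂ) - 1))
        (fun s : ℝ => ((s ^ (x - 1) * (1 - s) ^ (z - 1) : ℝ) : ℂ)) (Set.uIcc 0 1) := by
      intro s hs
      rw [Set.uIcc_of_le zero_le_one] at hs
      have h1 : 0 ≤ 1 - s := by linarith [hs.2]
      simp only
      rw [Complex.ofReal_mul, Complex.ofReal_cpow hs.1, Complex.ofReal_cpow h1]
      push_cast
      rfl
    have hconv := Complex.betaIntegral_convergent (u := x) (v := z) (by simpa) (by simpa)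
    constructor
    · have := hconv.congr (hcongr.mono Set.uIoc_subset_uIcc)
      exact ⟨this.1.re, this.2.re⟩
    · have h := Complex.betaIntegral_eq_Gamma_mul_div x z (by simpa) (by simpa)
      rw [Complex.betaIntegral, intervalIntegral.integral_congr hcongr,
        intervalIntegral.integral_ofReal, ← Complex.ofReal_add, Complex.Gamma_ofReal,
        Complex.Gamma_ofReal, Complex.Gamma_ofReal] at h
      exact_mod_cast h
  obtain ⟨hi, hval⟩ := hint
  rw [integral_rpow_mul_one_add_rpow_eq, add_comm x z, integral_rpow_mul_one_add_rpow_eq,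
    add_comm z x, ← hval]
  have hsub := intervalIntegral.integral_comp_sub_left (a := (0 : ℝ)) (b := 1 / 2)
    (fun s : ℝ => s ^ (x - 1) * (1 - s) ^ (z - 1)) 1
  have e : ∫ s in (0 : ℝ)..(1 / 2), s ^ (z - 1) * (1 - s) ^ (x - 1) =
      ∫ s in (1 / 2 : ℝ)..1, s ^ (x - 1) * (1 - s) ^ (z - 1) := by
    rw [sub_zero, show (1 : ℝ) - 1 / 2 = 1 / 2 by norm_num] at hsub
    rw [← hsub]
    refine intervalIntegral.integral_congr fun s _ => ?_
    simp only [sub_sub_cancel]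
    ring
  rw [e]
  refine intervalIntegral.integral_add_adjacent_intervals (hi.mono_set ?_) (hi.mono_set ?_) <;>
  · rw [Set.uIcc_of_le (by norm_num), Set.uIcc_of_le (by norm_num)]
    refine Set.Icc_subset_Icc (by norm_num) (by norm_num)

/-! ### Logarithmic moments on the unit interval -/

/-- The integral `∫₀¹ log^m(t) log^p(1 + t) dt / t`, a multiple of `S_{m+1,p}(-1)`. -/
noncomputable def logMoment (m p : ℕ) : ℝ :=
  ∫ t in (0 : ℝ)..1, Real.log t ^ m * Real.log (1 + t) ^ p / t

lemma pow_le_factorial_mul_exp {κ y : ℝ} (hκ : 0 < κ) (hy : 0 ≤ y) (m : ℕ) :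
    y ^ m ≤ m.factorial / κ ^ m * Real.exp (κ * y) := by
  have h := Real.pow_div_factorial_le_exp (κ * y) (by positivity) m
  rw [div_le_iff₀ (by positivity), mul_pow] at h
  rw [div_mul_eq_mul_div, le_div_iff₀ (by positivity)]
  linarith

lemma log_one_add_mem_Icc {t : ℝ} (ht : t ∈ Set.Ioc (0 : ℝ) 1) :
    0 ≤ Real.log (1 + t) ∧ Real.log (1 + t) ≤ t := by
  have h := Real.log_le_sub_one_of_pos (show 0 < 1 + t by linarith [ht.1])
  exact ⟨Real.log_nonneg (by linarith [ht.1]), by linarith⟩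

lemma intervalIntegrable_finset_sum {ι : Type*} (s : Finset ι) {f : ι → ℝ → ℝ} {a b : ℝ}
    (h : ∀ i ∈ s, IntervalIntegrable (f i) MeasureTheory.volume a b) :
    IntervalIntegrable (fun t => ∑ i ∈ s, f i t) MeasureTheory.volume a b := by
  simpa only [Finset.sum_fn] using IntervalIntegrable.sum s h

lemma intervalIntegrable_of_bound_rpow {f : ℝ → ℝ} (hf : Measurable f) {s C : ℝ} (hs : -1 < s)
    (h : ∀ t ∈ Set.Ioc (0 : ℝ) 1, |f t| ≤ C * t ^ s) :
    IntervalIntegrable f MeasureTheory.volume 0 1 := by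
  have hg := (intervalIntegral.intervalIntegrable_rpow' (a := 0) (b := 1) hs).const_mul C
  rw [intervalIntegrable_iff_integrableOn_Ioc_of_le zero_le_one] at hg ⊢
  refine MeasureTheory.Integrable.mono' hg hf.aestronglyMeasurable ?_
  exact (MeasureTheory.ae_restrict_mem measurableSet_Ioc).mono fun t ht => h t ht

/-- The index `p + 1 ≥ 1` of `log (1 + t)` makes the integral converge at `t = 0`. -/
lemma intervalIntegrable_logMoment (m p : ℕ) :
    IntervalIntegrable (fun t : ℝ => Real.log t ^ m * Real.log (1 + t) ^ (p + 1) / t)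
      MeasureTheory.volume 0 1 := by
  refine intervalIntegrable_of_bound_rpow (s := -(1 / 2)) (C := m.factorial / (1 / 2) ^ m)
    (by fun_prop) (by norm_num) fun t ht => ?_
  obtain ⟨h0, h1⟩ := log_one_add_mem_Icc ht
  have ht0 : 0 < t := ht.1
  have hL : Real.log t ≤ 0 := Real.log_nonpos ht0.le ht.2
  have hpow := pow_le_factorial_mul_exp (κ := 1 / 2) (by norm_num) (abs_nonneg (Real.log t)) m
  have hexp : Real.exp (1 / 2 * |Real.log t|) = t ^ (-(1 / 2) : ℝ) := by
    rw [Real.rpow_def_of_pos ht0, abs_of_nonpos hL]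
    ring_nf
  rw [hexp] at hpow
  rw [abs_div, abs_mul, abs_pow, abs_pow, abs_of_nonneg h0, abs_of_pos ht0, mul_div_assoc]
  have hfrac : Real.log (1 + t) ^ (p + 1) / t ≤ 1 := by
    rw [div_le_one ht0, pow_succ]
    calc _ ≤ 1 * t := by
          gcongr
          exact pow_le_one₀ h0 (h1.trans ht.2)
      _ = t := one_mul t
  calc _ ≤ |Real.log t| ^ m * 1 := by gcongr
    _ ≤ _ := by rw [mul_one]; exact hpow

/-- The integral `∫₀¹ ((a log t - b log(1 + t))^k - (a log t)^k) dt / t`, given by its binomial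
expansion; `integral_powMoment` identifies the two. -/
noncomputable def powMoment (a b : ℝ) (k : ℕ) : ℝ :=
  ∑ p ∈ Finset.range k, (-b) ^ (p + 1) * a ^ (k - (p + 1)) * k.choose (p + 1) *
    logMoment (k - (p + 1)) (p + 1)

lemma sub_pow_div_eq_sum (a b L M t : ℝ) (k : ℕ) :
    ((a * L - b * M) ^ k - (a * L) ^ k) / t = ∑ p ∈ Finset.range k, (-b) ^ (p + 1) *
      a ^ (k - (p + 1)) * k.choose (p + 1) * (L ^ (k - (p + 1)) * M ^ (p + 1) / t) := by
  have h : (a * L - b * M) ^ k = ∑ p ∈ Finset.range k, (-b * M) ^ (p + 1) *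
      (a * L) ^ (k - (p + 1)) * k.choose (p + 1) + (a * L) ^ k := by
    rw [show a * L - b * M = -b * M + a * L by ring, add_pow, Finset.sum_range_succ']
    simp
  rw [h, add_sub_cancel_right, Finset.sum_div]
  refine Finset.sum_congr rfl fun p _ => ?_
  rw [mul_pow, mul_pow]
  ring

lemma intervalIntegrable_powMoment (a b : ℝ) (k : ℕ) :
    IntervalIntegrable (fun t : ℝ => ((a * Real.log t - b * Real.log (1 + t)) ^ k -
      (a * Real.log t) ^ k) / t) MeasureTheory.volume 0 1 := by
  simp_rw [sub_pow_div_eq_sum]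
  exact intervalIntegrable_finset_sum _ fun p _ => (intervalIntegrable_logMoment _ p).const_mul _

lemma integral_powMoment (a b : ℝ) (k : ℕ) :
    ∫ t in (0 : ℝ)..1, ((a * Real.log t - b * Real.log (1 + t)) ^ k -
      (a * Real.log t) ^ k) / t = powMoment a b k := by
  simp_rw [sub_pow_div_eq_sum]
  rw [intervalIntegral.integral_finsetSum
    fun p _ => (intervalIntegrable_logMoment _ p).const_mul _]
  simp_rw [intervalIntegral.integral_const_mul]
  rfl

/-- A Lipschitz estimate for the Taylor remainder of `exp`. The factor `|u - v|` is what compensates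
the pole of `dt / t` when this is applied under the integral sign. -/
lemma abs_exp_remainder_sub_le {u v K : ℝ} (hu : |u| ≤ K) (hv : |v| ≤ K) (n : ℕ) :
    |(Real.exp u - Real.exp v) -
      ∑ k ∈ Finset.range (n + 1), 1 / (k.factorial : ℝ) * (u ^ k - v ^ k)| ≤
      K ^ n * Real.exp K * |u - v| := by
  have hder : ∀ y ∈ Set.Icc (-K) K, HasDerivWithinAt
      (fun y : ℝ => Real.exp y - ∑ k ∈ Finset.range (n + 1), 1 / (k.factorial : ℝ) * y ^ k)
      (Real.exp y - ∑ k ∈ Finset.range n, y ^ k / k.factorial) (Set.Icc (-K) K) y := by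
    intro y _
    have h : HasDerivAt (fun y : ℝ => ∑ k ∈ Finset.range (n + 1), 1 / (k.factorial : ℝ) * y ^ k)
        (∑ k ∈ Finset.range (n + 1), 1 / (k.factorial : ℝ) * (k * y ^ (k - 1))) y :=
      HasDerivAt.fun_sum fun k _ => (hasDerivAt_pow k y).const_mul _
    rw [Finset.sum_range_succ'] at h
    have e : ∑ k ∈ Finset.range n, 1 / (((k + 1).factorial : ℕ) : ℝ) *
        (((k + 1 : ℕ) : ℝ) * y ^ (k + 1 - 1)) + 1 / ((Nat.factorial 0 : ℕ) : ℝ) *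
        (((0 : ℕ) : ℝ) * y ^ (0 - 1)) = ∑ k ∈ Finset.range n, y ^ k / k.factorial := by
      simp only [Nat.cast_zero, zero_mul, mul_zero, add_zero]
      refine Finset.sum_congr rfl fun k _ => ?_
      rw [Nat.factorial_succ, Nat.add_sub_cancel]
      push_cast
      field_simp
    rw [e] at h
    exact ((Real.hasDerivAt_exp y).sub h).hasDerivWithinAt
  have hbound : ∀ y ∈ Set.Icc (-K) K,
      ‖Real.exp y - ∑ k ∈ Finset.range n, y ^ k / k.factorial‖ ≤ K ^ n * Real.exp K := by
    intro y hy
    have hyK : |y| ≤ K := abs_le.2 hy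
    have h := Complex.norm_exp_sub_sum_le_norm_mul_exp (y : ℂ) n
    have h' : ‖Real.exp y - ∑ k ∈ Finset.range n, y ^ k / k.factorial‖ ≤
        |y| ^ n * Real.exp |y| := by
      rw [Complex.norm_real] at h
      rw [← Complex.norm_real]
      push_cast
      exact h
    have hK : 0 ≤ K := (abs_nonneg y).trans hyK
    refine h'.trans ?_
    gcongr
  have := (convex_Icc (-K) K).norm_image_sub_le_of_norm_hasDerivWithin_le hder hbound
    (abs_le.1 hv) (abs_le.1 hu)
  refine le_trans (le_of_eq ?_) this
  rw [Real.norm_eq_abs]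
  simp_rw [mul_sub]
  rw [Finset.sum_sub_distrib]
  congr 1
  ring

/-- The Taylor polynomial in `ε` of `∫₀¹ (t^(aε) (1 + t)^(-bε) - t^(aε)) dt / t`. -/
noncomputable def betaTrunc (a b : ℝ) (n : ℕ) : ℝ[X] :=
  ∑ k ∈ Finset.range (n + 1), C (1 / (k.factorial : ℝ) * powMoment a b k) * X ^ k

lemma intervalIntegrable_exp_sub_exp {a b ε : ℝ} (ha : 0 < a) (hb : 0 ≤ b) (hε : 0 < ε) :
    IntervalIntegrable (fun t : ℝ =>
      (Real.exp (ε * (a * Real.log t - b * Real.log (1 + t))) - Real.exp (ε * (a * Real.log t))) / t)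
      MeasureTheory.volume 0 1 := by
  refine intervalIntegrable_of_bound_rpow (s := ε * a - 1) (C := 1) (by fun_prop)
    (by linarith [mul_pos hε ha]) fun t ht => ?_
  have ht0 : 0 < t := ht.1
  have hM := (log_one_add_mem_Icc ht).1
  have h1 : t ^ (ε * a - 1) = Real.exp (ε * (a * Real.log t)) / t := by
    rw [Real.rpow_sub_one ht0.ne', Real.rpow_def_of_pos ht0]
    ring_nf
  have h2 : Real.exp (ε * (a * Real.log t - b * Real.log (1 + t))) ≤
      Real.exp (ε * (a * Real.log t)) := by
    gcongr
    linarith [mul_nonneg hb hM]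
  rw [one_mul, h1, abs_div, abs_of_pos ht0]
  gcongr
  rw [abs_sub_comm, abs_of_nonneg (by linarith)]
  linarith [Real.exp_pos (ε * (a * Real.log t - b * Real.log (1 + t)))]

lemma integral_exp_sub_exp {a b ε : ℝ} (ha : 0 < a) (hb : 0 ≤ b) (hε : 0 < ε) :
    ∫ t in (0 : ℝ)..1, (Real.exp (ε * (a * Real.log t - b * Real.log (1 + t))) -
      Real.exp (ε * (a * Real.log t))) / t =
      (∫ t in (0 : ℝ)..1, t ^ (ε * a - 1) * (1 + t) ^ (-(ε * b))) - 1 / (ε * a) := by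
  have hs : -1 < ε * a - 1 := by linarith [mul_pos hε ha]
  have hpow : ∫ t in (0 : ℝ)..1, t ^ (ε * a - 1) = 1 / (ε * a) := by
    rw [integral_rpow (Or.inl hs), sub_add_cancel, Real.one_rpow,
      Real.zero_rpow (mul_pos hε ha).ne', sub_zero]
  have hrpow := intervalIntegral.intervalIntegrable_rpow' (a := 0) (b := 1) hs
  have hcongr : Set.EqOn (fun t : ℝ => t ^ (ε * a - 1) * (1 + t) ^ (-(ε * b)))
      (fun t : ℝ => (Real.exp (ε * (a * Real.log t - b * Real.log (1 + t))) -
        Real.exp (ε * (a * Real.log t))) / t + t ^ (ε * a - 1)) (Set.uIoc 0 1) := by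
    intro t ht
    rw [Set.uIoc_of_le zero_le_one] at ht
    have ht0 : 0 < t := ht.1
    have h1 : t ^ (ε * a - 1) = Real.exp (ε * (a * Real.log t)) / t := by
      rw [Real.rpow_sub_one ht0.ne', Real.rpow_def_of_pos ht0]
      ring_nf
    have h2 : Real.exp (ε * (a * Real.log t - b * Real.log (1 + t))) =
        Real.exp (ε * (a * Real.log t)) * (1 + t) ^ (-(ε * b)) := by
      rw [Real.rpow_def_of_pos (by linarith), ← Real.exp_add]
      ring_nf
    simp only
    rw [h1, h2]
    ring
  rw [intervalIntegral.integral_congr_ae (MeasureTheory.ae_of_all _ hcongr),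
    intervalIntegral.integral_add (intervalIntegrable_exp_sub_exp ha hb hε) hrpow, hpow, add_sub_cancel_right]

/-- Term by term integration of the exponential series in `ε`, up to order `n`. -/
lemma integral_exp_sub_betaTrunc_isBigO {a b : ℝ} (ha : 0 < a) (hb : 0 < b) (n : ℕ) :
    (fun ε : ℝ => (∫ t in (0 : ℝ)..1, (Real.exp (ε * (a * Real.log t - b * Real.log (1 + t))) -
      Real.exp (ε * (a * Real.log t))) / t) - (betaTrunc a b n).eval ε) =O[𝓝[>] 0]
      fun ε : ℝ => ε ^ (n + 1) := by
  -- For `ε < δ` both exponents are at most `ε Y` in absolute value, with `Y = a |log t| + b`, and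
  -- `Y ^ n * exp (ε Y)` is at most a multiple of `exp (2 δ Y)`. For `δ = 1 / (4 a)` this is a
  -- multiple of `t ^ (-2 δ a) = t ^ (-1 / 2)`, which is integrable.
  set δ : ℝ := 1 / (4 * a) with hδ
  have hδ0 : 0 < δ := by positivity
  set D : ℝ := b * (n.factorial / δ ^ n * Real.exp (2 * (δ * b))) with hD
  refine IsBigO.of_bound (∫ t in (0 : ℝ)..1, D * t ^ (-(1 / 2) : ℝ)) ?_
  filter_upwards [Ioo_mem_nhdsGT hδ0] with ε hε
  have hε0 : 0 < ε := hε.1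
  have heval : (betaTrunc a b n).eval ε = ∫ t in (0 : ℝ)..1, ∑ k ∈ Finset.range (n + 1),
      1 / (k.factorial : ℝ) * ε ^ k * (((a * Real.log t - b * Real.log (1 + t)) ^ k -
        (a * Real.log t) ^ k) / t) := by
    rw [intervalIntegral.integral_finsetSum
      fun k _ => (intervalIntegrable_powMoment a b k).const_mul _]
    simp_rw [intervalIntegral.integral_const_mul, integral_powMoment]
    simp only [betaTrunc, eval_finsetSum, eval_mul, eval_C, eval_pow, eval_X]
    refine Finset.sum_congr rfl fun k _ => ?_
    ring
  rw [heval, ← intervalIntegral.integral_sub (intervalIntegrable_exp_sub_exp ha hb.le hε0)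
    (intervalIntegrable_finset_sum _ fun k _ => (intervalIntegrable_powMoment a b k).const_mul _),
    Real.norm_of_nonneg (show 0 ≤ ε ^ (n + 1) by positivity), mul_comm,
    ← intervalIntegral.integral_const_mul]
  refine intervalIntegral.norm_integral_le_of_norm_le zero_le_one
    (MeasureTheory.ae_of_all _ fun t ht => ?_)
    (((intervalIntegral.intervalIntegrable_rpow' (by norm_num)).const_mul _).const_mul _)
  have ht0 : 0 < t := ht.1
  obtain ⟨hM0, hM1⟩ := log_one_add_mem_Icc ht
  have hL : Real.log t ≤ 0 := Real.log_nonpos ht0.le ht.2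
  set L := Real.log t with hLdef
  set M := Real.log (1 + t) with hMdef
  set Y : ℝ := a * (-L) + b with hY
  have haL : 0 ≤ a * (-L) := mul_nonneg ha.le (by linarith)
  have hbM : 0 ≤ b * M := by positivity
  have hbM1 : b * M ≤ b * t := by gcongr
  have hbt : b * t ≤ b := mul_le_of_le_one_right hb.le ht.2
  have hY0 : 0 ≤ Y := by positivity
  have hu : |ε * (a * L - b * M)| ≤ ε * Y := by
    rw [abs_mul, abs_of_pos hε0]
    gcongr
    rw [abs_le]
    constructor <;> linarith
  have hv : |ε * (a * L)| ≤ ε * Y := by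
    rw [abs_mul, abs_of_pos hε0]
    gcongr
    rw [abs_le]
    constructor <;> linarith
  have hrem := abs_exp_remainder_sub_le hu hv n
  have hdiff : |ε * (a * L - b * M) - ε * (a * L)| ≤ ε * (b * t) := by
    rw [← mul_sub, abs_mul, abs_of_pos hε0]
    gcongr
    rw [abs_le]
    constructor <;> linarith
  have hYn := pow_le_factorial_mul_exp hδ0 hY0 n
  have hexpY : Real.exp (ε * Y) ≤ Real.exp (δ * Y) := by
    gcongr
    exact hε.2.le
  have hexp2 : Real.exp (δ * Y) * Real.exp (δ * Y) =
      Real.exp (2 * (δ * b)) * t ^ (-(1 / 2) : ℝ) := by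
    rw [Real.rpow_def_of_pos ht0, ← Real.exp_add, ← Real.exp_add, ← hLdef, hY, hδ]
    congr 1
    field_simp
    ring
  have hform : (Real.exp (ε * (a * L - b * M)) - Real.exp (ε * (a * L))) / t -
      ∑ k ∈ Finset.range (n + 1), 1 / (k.factorial : ℝ) * ε ^ k *
        (((a * L - b * M) ^ k - (a * L) ^ k) / t) =
      ((Real.exp (ε * (a * L - b * M)) - Real.exp (ε * (a * L))) -
        ∑ k ∈ Finset.range (n + 1), 1 / (k.factorial : ℝ) * ((ε * (a * L - b * M)) ^ k -
          (ε * (a * L)) ^ k)) / t := by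
    conv_rhs => rw [sub_div, Finset.sum_div]
    congr 1
    refine Finset.sum_congr rfl fun k _ => ?_
    rw [mul_pow ε, mul_pow ε]
    ring
  rw [hform, Real.norm_eq_abs, abs_div, abs_of_pos ht0, div_le_iff₀ ht0]
  calc _ ≤ _ := hrem
    _ ≤ (ε * Y) ^ n * Real.exp (δ * Y) * (ε * (b * t)) := by gcongr
    _ = ε ^ (n + 1) * b * (Y ^ n * Real.exp (δ * Y)) * t := by
        rw [mul_pow, pow_succ]; ring
    _ ≤ ε ^ (n + 1) * b * ((n.factorial / δ ^ n * Real.exp (δ * Y)) * Real.exp (δ * Y)) * t := by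
        gcongr
    _ = ε ^ (n + 1) * b * (n.factorial / δ ^ n * (Real.exp (δ * Y) * Real.exp (δ * Y))) * t := by
        ring
    _ = _ := by rw [hexp2, hD]; ring

/-! ### The functional equation and its degree `8` coefficient -/

/-- The polynomial `r` for which `X ^ 2 * r` is the Taylor polynomial in `ε` of degree `8` of
`log (Γ(1 + a ε) Γ(1 + c ε) / Γ(1 + (a + c) ε))`. -/
noncomputable def logTrunc (a c : ℝ) : ℝ[X] :=
  ∑ k ∈ Finset.range 7, C ((-1) ^ (k + 1) / (k + 2) * ((a + c) ^ (k + 2) - a ^ (k + 2) -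
    c ^ (k + 2)) * zetaSeries (k + 2)) * X ^ k

/-- The left side is `Γ(1 + a ε) Γ(1 + c ε) / Γ(1 + (a + c) ε)`, written without the shifts by `1`. -/
lemma Gamma_ratio_sub_expTrunc_isBigO {a c : ℝ} (ha : 0 < a) (hc : 0 < c) :
    (fun ε : ℝ => ε * a * (ε * c) / (ε * a + ε * c) * (Real.Gamma (ε * a) * Real.Gamma (ε * c) /
      Real.Gamma (ε * a + ε * c)) - (expTrunc (X ^ 2 * logTrunc a c)).eval ε) =O[𝓝[>] 0]
      fun ε : ℝ => ε ^ 9 := by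
  have hlog : (fun ε : ℝ => Real.log (ε * a * (ε * c) / (ε * a + ε * c) *
      (Real.Gamma (ε * a) * Real.Gamma (ε * c) / Real.Gamma (ε * a + ε * c))) -
      (X ^ 2 * logTrunc a c).eval ε) =O[𝓝[>] 0] fun ε : ℝ => ε ^ 9 := by
    refine IsBigO.of_bound (6 * (a + c) ^ 9 * zetaSeries 9) ?_
    have hδ : 0 < 1 / (2 * (a + c)) := by positivity
    filter_upwards [Ioo_mem_nhdsGT hδ] with ε hε
    have hε0 : 0 < ε := hε.1
    have hle : ε * a + ε * c ≤ 1 / 2 := by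
      have := (lt_div_iff₀ (by positivity)).1 hε.2
      linarith
    have h := abs_log_Gamma_ratio_sub_taylor_le (mul_pos hε0 ha) (mul_pos hε0 hc) hle 7
    have e : (X ^ 2 * logTrunc a c).eval ε = ∑ k ∈ Finset.range 7, (-1) ^ (k + 1) / ((k : ℝ) + 2) *
        ((ε * a + ε * c) ^ (k + 2) - (ε * a) ^ (k + 2) - (ε * c) ^ (k + 2)) *
        zetaSeries (k + 2) := by
      simp only [logTrunc, eval_mul, eval_finsetSum, eval_C, eval_pow, eval_X]
      rw [Finset.mul_sum]
      refine Finset.sum_congr rfl fun k _ => ?_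
      rw [← mul_add, mul_pow, mul_pow, mul_pow]
      ring
    rw [e, Real.norm_eq_abs, Real.norm_of_nonneg (by positivity)]
    refine h.trans (le_of_eq ?_)
    rw [← mul_add, mul_pow]
    ring
  refine (exp_sub_expTrunc_isBigO hlog).congr' ?_ EventuallyEq.rfl
  filter_upwards [self_mem_nhdsWithin] with ε hε
  have hε0 : (0 : ℝ) < ε := hε
  have h1 := Real.Gamma_pos_of_pos (mul_pos hε0 ha)
  have h2 := Real.Gamma_pos_of_pos (mul_pos hε0 hc)
  have h3 := Real.Gamma_pos_of_pos (add_pos (mul_pos hε0 ha) (mul_pos hε0 hc))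
  rw [Real.exp_log (by positivity)]

/-- The coefficient is a sum over the partitions of `8` into parts `≥ 2`, the part `k + 2` carrying
the weight `d k`. -/
lemma coeff_expTrunc_eight (d : ℕ → ℝ) :
    (expTrunc (X ^ 2 * ∑ k ∈ Finset.range 7, C (d k) * X ^ k)).coeff 8 =
      d 6 + (d 0 * d 4 + d 1 * d 3 + d 2 ^ 2 / 2) + (d 0 ^ 2 * d 2 + d 0 * d 1 ^ 2) / 2 +
        d 0 ^ 4 / 24 := by
  set r : ℝ[X] := ∑ k ∈ Finset.range 7, C (d k) * X ^ k with hr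
  have hcoeff : ∀ k < 7, r.coeff k = d k := by
    intro k hk
    simp [hr, finsetSum_coeff, coeff_X_pow, hk]
  have h1 : (X ^ 2 * r).coeff 8 = d 6 := by
    rw [show 8 = 6 + 2 from rfl, coeff_X_pow_mul, hcoeff 6 (by norm_num)]
  have h2 : ((X ^ 2 * r) ^ 2).coeff 8 = 2 * d 0 * d 4 + 2 * d 1 * d 3 + d 2 ^ 2 := by
    rw [mul_pow, ← pow_mul, show 8 = 4 + 2 * 2 from rfl, coeff_X_pow_mul, pow_two, coeff_mul,
      Finset.Nat.sum_antidiagonal_eq_sum_range_succ (fun i j => r.coeff i * r.coeff j)]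
    simp [Finset.sum_range_succ, hcoeff]
    ring
  have h3 : ((X ^ 2 * r) ^ 3).coeff 8 = 3 * d 0 ^ 2 * d 2 + 3 * d 0 * d 1 ^ 2 := by
    rw [mul_pow, ← pow_mul, show 8 = 2 + 2 * 3 from rfl, coeff_X_pow_mul, pow_succ, pow_two]
    simp [coeff_mul, Finset.Nat.sum_antidiagonal_eq_sum_range_succ_mk, Finset.sum_range_succ,
      hcoeff]
    ring
  have h4 : ((X ^ 2 * r) ^ 4).coeff 8 = d 0 ^ 4 := by
    rw [mul_pow, ← pow_mul, show 8 = 0 + 2 * 4 from rfl, coeff_X_pow_mul]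
    simp [coeff_zero_eq_eval_zero, ← hcoeff 0]
  rw [expTrunc, coeff_add, coeff_add, coeff_add, coeff_add, coeff_C_mul, coeff_C_mul, coeff_C_mul,
    h1, h2, h3, h4, coeff_one]
  norm_num
  ring

/-- Comparison of the coefficients of `ε ^ 8` in the Beta integral at `(a ε, c ε)`: on the side of
the integral they are logarithmic moments, on the side of the Gamma function zeta values. -/
lemma powMoment_add_powMoment {a c : ℝ} (ha : 0 < a) (hc : 0 < c) :
    1 / (Nat.factorial 7 : ℝ) * (powMoment a (a + c) 7 + powMoment c (a + c) 7) =
      (a + c) / (a * c) * (expTrunc (X ^ 2 * logTrunc a c)).coeff 8 := by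
  set b := a + c with hb
  have hb0 : 0 < b := add_pos ha hc
  set P : ℝ[X] := C (b / (a * c)) * expTrunc (X ^ 2 * logTrunc a c) -
    C (b / (a * c)) - X * (betaTrunc a b 7 + betaTrunc c b 7) with hP
  have hO : (fun ε : ℝ => P.eval ε) =O[𝓝[>] 0] fun ε : ℝ => ε ^ 9 := by
    have h1 := (Gamma_ratio_sub_expTrunc_isBigO ha hc).const_mul_left (b / (a * c))
    have h2 := (isBigO_refl (fun ε : ℝ => ε) (𝓝[>] 0)).mul
      ((integral_exp_sub_betaTrunc_isBigO ha hb0 7).add (integral_exp_sub_betaTrunc_isBigO hc hb0 7))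
    refine ((h2.congr_right (fun ε => ?_)).sub h1).congr' ?_ EventuallyEq.rfl
    · ring
    · filter_upwards [self_mem_nhdsWithin] with ε hε
      have hε0 : (0 : ℝ) < ε := hε
      have hbeta := integral_add_integral_eq_Gamma (mul_pos hε0 ha) (mul_pos hε0 hc)
      rw [← mul_add, ← hb] at hbeta
      rw [integral_exp_sub_exp ha hb0.le hε0, integral_exp_sub_exp hc hb0.le hε0, ← mul_add, ← hb,
        ← hbeta]
      simp only [hP, eval_sub, eval_mul, eval_C, eval_X, eval_add]
      have hfactor : b / (a * c) * (ε * a * (ε * c) / (ε * b)) = ε := by field_simp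
      have hpole : ε * (1 / (ε * a) + 1 / (ε * c)) = b / (a * c) := by
        rw [hb]; field_simp; ring
      linear_combination -(∫ t in (0 : ℝ)..1, t ^ (ε * a - 1) * (1 + t) ^ (-(ε * b))) * hfactor -
        (∫ t in (0 : ℝ)..1, t ^ (ε * c - 1) * (1 + t) ^ (-(ε * b))) * hfactor - hpole
  have h8 := Polynomial.coeff_eq_zero_of_eval_isBigO_pow hO (show 8 < 9 by norm_num)
  have hcoeff : ∀ a' : ℝ, (betaTrunc a' b 7).coeff 7 =
      1 / (Nat.factorial 7 : ℝ) * powMoment a' b 7 := by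
    intro a'
    simp only [betaTrunc, finsetSum_coeff, coeff_C_mul, coeff_X_pow]
    simp
  rw [hP, coeff_sub, coeff_sub, coeff_C_mul, coeff_C_of_ne_zero (by norm_num),
    show 8 = 7 + 1 from rfl, coeff_X_mul, coeff_add, hcoeff, hcoeff] at h8
  linarith

/-! ### Evaluation of the moments -/

lemma zetaSeries_two_mul {k : ℕ} (hk : k ≠ 0) :
    zetaSeries (2 * k) = (-1) ^ (k + 1) * 2 ^ (2 * k - 1) * Real.pi ^ (2 * k) *
      _root_.bernoulli (2 * k) / (2 * k).factorial := by
  rw [← Complex.ofReal_inj, ofReal_zetaSeries (by lia)]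
  push_cast
  exact riemannZeta_two_mul_nat hk

lemma zetaSeries_two : zetaSeries 2 = Real.pi ^ 2 / 6 := by
  rw [zetaSeries_two_mul (k := 1) one_ne_zero]
  norm_num [_root_.bernoulli_two, Nat.factorial]
  ring

lemma zetaSeries_four : zetaSeries 4 = Real.pi ^ 4 / 90 := by
  rw [zetaSeries_two_mul (k := 2) two_ne_zero]
  norm_num [_root_.bernoulli, bernoulli'_four, Nat.factorial]
  ring

lemma bernoulli'_five : bernoulli' 5 = 0 := by
  rw [bernoulli'_def]
  norm_num [Finset.sum_range_succ, Nat.choose]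

lemma bernoulli'_six : bernoulli' 6 = 1 / 42 := by
  rw [bernoulli'_def]
  norm_num [Finset.sum_range_succ, Nat.choose, bernoulli'_five]

lemma bernoulli'_seven : bernoulli' 7 = 0 := by
  rw [bernoulli'_def]
  norm_num [Finset.sum_range_succ, Nat.choose, bernoulli'_five, bernoulli'_six]

lemma bernoulli'_eight : bernoulli' 8 = -1 / 30 := by
  rw [bernoulli'_def]
  norm_num [Finset.sum_range_succ, Nat.choose, bernoulli'_five, bernoulli'_six, bernoulli'_seven]

lemma zetaSeries_six : zetaSeries 6 = Real.pi ^ 6 / 945 := by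
  rw [zetaSeries_two_mul (k := 3) three_ne_zero]
  norm_num [_root_.bernoulli, bernoulli'_six, Nat.factorial]
  ring

lemma zetaSeries_eight : zetaSeries 8 = Real.pi ^ 8 / 9450 := by
  rw [zetaSeries_two_mul (k := 4) four_ne_zero]
  norm_num [_root_.bernoulli, bernoulli'_eight, Nat.factorial]
  ring

lemma nielsenS_neg_one (n p : ℕ) :
    nielsenS n p (-1) = (-1) ^ (n + p - 1) / ((n - 1).factorial * p.factorial) *
      (logMoment (n - 1) p : ℂ) := by
  rw [nielsenS, logMoment, ← intervalIntegral.integral_ofReal]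
  congr 1
  refine intervalIntegral.integral_congr fun t ht => ?_
  rw [Set.uIcc_of_le zero_le_one] at ht
  have h : Complex.log (1 - -1 * (t : ℂ)) = (Real.log (1 + t) : ℂ) := by
    rw [Complex.ofReal_log (by linarith [ht.1])]
    congr 1
    push_cast
    ring
  simp only [h]
  push_cast
  rfl

/-- The combination of the moments with which `5 / 2 * S_{6,2}(-1) - S_{5,3}(-1)` is computed. -/
lemma logMoment_combination :
    -(1 / 96) * logMoment 5 2 + 1 / 144 * logMoment 4 3 =
      -(917 / 768) * zetaSeries 8 + 1 / 2 * zetaSeries 3 * zetaSeries 5 +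
        1 / 4 * zetaSeries 2 * zetaSeries 3 ^ 2 := by
  have key := fun c : ℝ => fun hc : 0 < c => powMoment_add_powMoment one_pos hc
  have h1 := key 1 (by norm_num)
  have h2 := key 2 (by norm_num)
  have h3 := key 3 (by norm_num)
  have h4 := key 4 (by norm_num)
  rw [logTrunc, coeff_expTrunc_eight] at h1 h2 h3 h4
  norm_num [powMoment, Finset.sum_range_succ, Nat.choose, Nat.factorial, zetaSeries_two,
    zetaSeries_four, zetaSeries_six, zetaSeries_eight] at h1 h2 h3 h4 ⊢
  -- In the coordinates `b = a + c` and `u = (c - a) / 2` each side is `2 b` times an even form of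
  -- degree `6` in `(u, b)`, evaluated at `(a, c) = (1, 1), (1, 2), (1, 3), (1, 4)`. The weights
  -- extract `15 / 4` times the coefficient of `u ^ 6` of the form minus that of `u ^ 4 * b ^ 2`.
  linear_combination -(14149 / 144) * h1 + 223 / 15 * h2 - 3481 / 1760 * h3 + 79 / 495 * h4

theorem mainTheorem10 :
    (5 / 2 : ℂ) * nielsenS 6 2 (-1) - nielsenS 5 3 (-1) =
      -(917 / 768 : ℂ) * riemannZeta 8 + (1 / 2 : ℂ) * riemannZeta 3 * riemannZeta 5 +
        (1 / 4 : ℂ) * riemannZeta 2 * riemannZeta 3 ^ 2 := by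
  have h := congrArg (fun y : ℝ => (y : ℂ)) logMoment_combination
  have z2 := ofReal_zetaSeries (k := 2) (by norm_num)
  have z3 := ofReal_zetaSeries (k := 3) (by norm_num)
  have z5 := ofReal_zetaSeries (k := 5) (by norm_num)
  have z8 := ofReal_zetaSeries (k := 8) (by norm_num)
  push_cast at h z2 z3 z5 z8
  rw [z2, z3, z5, z8] at h
  rw [nielsenS_neg_one, nielsenS_neg_one, ← h]
  norm_num [Nat.factorial]
  ring
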